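/- Fix $\eta>50$ and put $\alpha_1^*=0.002$, $\alpha_2^*=7$. For $n$ large let $(G_t)_{t\in\mathbb Z}$ be a sequence of independent Erdős–Rényi graphs on $[n]=\{1,\dots,n\}$ in which each edge is present with probability $p=\frac{\eta\log n}{n-1}$, and let $\mathbf P$ denote its law. Let $P_t$ be the transition matrix of the lazy simple random walk on $G_t$: for $x\ne y$, $P_t(x,y)=\frac1{2\deg_t(x)}$ if $x,y$ are adjacent in $G_t$ and $P_t(x,y)=0$ otherwise; $P_t(x,x)=\frac12$ if $\deg_t(x)\ge1$ and $P_t(x,x)=1$ if $\deg_t(x)=0$. Write $P^{s,t}=P_{s+1}\cdots P_t$ for $s<t$, and let $\pi_t(y)=\lim_{s\to-\infty}P^{s,t}(x,y)$ whenever this limit exists for all $x,y\in[n]$ and does not depend on $x$ (we then say that $\pi_t$ exists). For $A,B\subset[n]$ put $\pi_t(A)=\sum_{x\in A}\pi_t(x)$ and $Q_t(A,B)=\sum_{x\in A}\sum_{y\in B}\pi_{t-1}(x)P_t(x,y)$, and define $$g_t=\min_{z\in[n]}\frac{\pi_{t-1}(z)}{\pi_t(z)},\qquad \Phi_t(S)=\frac{Q_t(S,S^c)+Q_t(S^c,S)}{2\pi_{t-1}(S)},$$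 $$\Phi_t^*=\inf\Big\{\Phi_t(S):\emptyset\ne S\subset[n],\ \pi_{t-1}(S)\le\tfrac12\Big\},\qquad \Theta_t=\min_{1\le s\le t}\bigg(\frac12\,\frac{g_s}{1-\frac12 g_s}\,\Phi_s^*\bigg)^2,$$ with $\Theta_0=+\infty$ (empty minimum). Then $$\lim_{n\to\infty}\mathbf P\Bigg(\pi_t\text{ exists for all }t\in\mathbb Z,\ \text{ and }\ \Theta_t\ge\bigg(\frac{\alpha_1^*}{2\alpha_2^*-\alpha_1^*}\cdot\frac{\alpha_1^*}{32(\alpha_2^*)^2}\bigg)^2\ \text{ for all }t\in\{0,\dots,n\}\Bigg)=1.$$ -/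

import Mathlib

open MeasureTheory Filter Topology

noncomputable section

namespace DynamicGraph

/-- The product `P^{s,t} = P_{s+1} P_{s+2} ⋯ P_t` of a sequence of matrices indexed by `ℤ`
(the identity if `t ≤ s`). -/
def transitionProd {V : Type*} [Fintype V] [DecidableEq V]
    (P : ℤ → Matrix V V ℝ) (s t : ℤ) : Matrix V V ℝ :=
  ((List.range (t - s).toNat).map fun k : ℕ => P (s + 1 + (k : ℤ))).prod

/-- `μ` is the target distribution at time `t`: for every starting state `x`,
`P^{s,t}(x, ·) → μ` as `s → -∞`, the limit being the same for all `x`. -/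
def IsTarget {V : Type*} [Fintype V] [DecidableEq V]
    (P : ℤ → Matrix V V ℝ) (t : ℤ) (μ : V → ℝ) : Prop :=
  ∀ x y : V, Tendsto (fun s : ℤ => transitionProd P s t x y) atBot (𝓝 (μ y))

/-- The statement that the target distribution `π_t` exists. -/
def TargetExists {V : Type*} [Fintype V] [DecidableEq V]
    (P : ℤ → Matrix V V ℝ) (t : ℤ) : Prop :=
  ∃ μ : V → ℝ, IsTarget P t μ

open Classical in
/-- The target distribution `π_t` (with the value `0` if it does not exist). -/
def target {V : Type*} [Fintype V] [DecidableEq V]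
    (P : ℤ → Matrix V V ℝ) (t : ℤ) : V → ℝ :=
  if h : TargetExists P t then h.choose else 0

/-- `π_t(S)`. -/
def targetMass {V : Type*} [Fintype V] [DecidableEq V]
    (P : ℤ → Matrix V V ℝ) (t : ℤ) (S : Finset V) : ℝ :=
  ∑ x ∈ S, target P t x

/-- The stationary flow `Q_t(A, B) = ∑_{x ∈ A} ∑_{y ∈ B} π_{t-1}(x) P_t(x, y)` from `A` to `B`
between the times `t - 1` and `t`. -/
def flow {V : Type*} [Fintype V] [DecidableEq V]
    (P : ℤ → Matrix V V ℝ) (t : ℤ) (A B : Finset V) : ℝ :=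
  ∑ y ∈ B, ∑ x ∈ A, target P (t - 1) x * P t x y

/-- `Φ_t(S) = (Q_t(S, Sᶜ) + Q_t(Sᶜ, S)) / (2 π_{t-1}(S))`. -/
def bottleneck {V : Type*} [Fintype V] [DecidableEq V]
    (P : ℤ → Matrix V V ℝ) (t : ℤ) (S : Finset V) : ℝ :=
  1 / (2 * targetMass P (t - 1) S) * (flow P t S Sᶜ + flow P t Sᶜ S)

/-- The time-dependent bottleneck ratio `Φ*_t`, the infimum of `Φ_t(S)` over the nonempty sets `S`
with `π_{t-1}(S) ≤ 1/2`. -/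
def bottleneckRatio {V : Type*} [Fintype V] [DecidableEq V]
    (P : ℤ → Matrix V V ℝ) (t : ℤ) : ℝ :=
  sInf {r : ℝ | ∃ S : Finset V, S.Nonempty ∧ targetMass P (t - 1) S ≤ 1 / 2 ∧
    r = bottleneck P t S}

/-- `g_t = min_z π_{t-1}(z) / π_t(z)`. -/
def changeRate {V : Type*} [Fintype V] [DecidableEq V]
    (P : ℤ → Matrix V V ℝ) (t : ℤ) : ℝ :=
  ⨅ z : V, target P (t - 1) z / target P t z

/-- `Θ_t = min_{1 ≤ s ≤ t} ((1/2) g_s / (1 - (1/2) g_s) * Φ*_s) ^ 2`. The values are extended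
reals, so that the empty minimum at `t = 0` is `+∞`. -/
def Theta {V : Type*} [Fintype V] [DecidableEq V]
    (P : ℤ → Matrix V V ℝ) (t : ℤ) : EReal :=
  ⨅ s ∈ Set.Icc (1 : ℤ) t,
    ((((1 / 2) * (changeRate P s / (1 - (1 / 2) * changeRate P s)) * bottleneckRatio P s) ^ 2 : ℝ)
      : EReal)

open Classical in
/-- The transition matrix of the lazy simple random walk on a finite graph; the walk does not move
from an isolated vertex. -/
def lazyWalk {V : Type*} [Fintype V] (G : SimpleGraph V) : Matrix V V ℝ :=
  Matrix.of fun x y =>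
    if x = y then (if 1 ≤ G.degree x then 1 / 2 else 1)
    else if G.Adj x y then 1 / (2 * (G.degree x : ℝ)) else 0

/-- The law of the dynamic Erdős–Rényi model: a sequence `(G_t)`, `t ∈ ℤ`, of independent binomial
random graphs on `n` vertices with edge probability `p`. -/
def dynamicER (n : ℕ) (p : unitInterval) : Measure (ℤ → SimpleGraph (Fin n)) :=
  Measure.infinitePi fun _ : ℤ => SimpleGraph.binomialRandom (Fin n) p

end DynamicGraph

end

/-
By Chernoff bounds, outside an event of probability `O(1 / n ^ 2)` the graph at a given time is a
nearly regular expander. The distribution of the walk started at time `s` is determined by the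
earlier graphs, hence independent of the current one, so outside another event of probability
`O(1 / n ^ 2)` the current neighbourhoods see it evenly: none of them carries more than `0.4` times
the mean degree times its peak. A lazy step then multiplies the peak by at most `0.9` until the
distribution is bounded by `7 / n`; from then on it stays bounded, and each step brings every point
above `0.035 / n`. For each starting time `s ≤ -n` this holds at all times in `[0, n]` with
probability `1 - O(1 / n)`, so with the same probability it holds for arbitrarily early `s`. Hence
the bounds pass to the targets, and they control the change rate and, through the expansion, the
bottleneck ratio.

The targets exist almost surely because the graph is complete infinitely often in the past and
each such step contracts the oscillation of the columns of the transition products.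
-/

namespace DynamicGraph

section TransitionProd

variable {V : Type*} [Fintype V] [DecidableEq V] {P : ℤ → Matrix V V ℝ}

lemma transitionProd_succ_right (P : ℤ → Matrix V V ℝ) {s t : ℤ} (h : s ≤ t) :
    transitionProd P s (t + 1) = transitionProd P s t * P (t + 1) := by
  have hlength : (t + 1 - s).toNat = (t - s).toNat + 1 := by omega
  have hlast : s + 1 + ((t - s).toNat : ℤ) = t + 1 := by omega
  rw [transitionProd, hlength, List.range_succ, List.map_append, List.prod_append,
    List.map_singleton, List.prod_singleton, hlast, transitionProd]

lemma transitionProd_pred_left (P : ℤ → Matrix V V ℝ) {s t : ℤ} (h : s ≤ t) :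
    transitionProd P (s - 1) t = P s * transitionProd P s t := by
  have hlength : (t - (s - 1)).toNat = (t - s).toNat + 1 := by omega
  have hshift : ∀ k : ℕ, s + ((k.succ : ℕ) : ℤ) = s + 1 + k := fun k => by push_cast; ring
  simp only [transitionProd, hlength, List.range_succ_eq_map, List.map_cons, List.map_map,
    List.prod_cons, Function.comp_def, sub_add_cancel, hshift, Nat.cast_zero, add_zero]

lemma transitionProd_congr {P P' : ℤ → Matrix V V ℝ} {s t : ℤ}
    (h : ∀ u ∈ Set.Ioc s t, P u = P' u) : transitionProd P s t = transitionProd P' s t := by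
  refine congrArg List.prod (List.map_congr_left fun k hk => h _ ?_)
  rw [List.mem_range] at hk
  rw [Set.mem_Ioc]
  omega

lemma transitionProd_mem_rowStochastic (hP : ∀ u, P u ∈ Matrix.rowStochastic ℝ V) (s t : ℤ) :
    transitionProd P s t ∈ Matrix.rowStochastic ℝ V :=
  Submonoid.list_prod_mem _ (List.forall_mem_map.2 fun _ _ => hP _)

lemma row_mem_stdSimplex {A : Matrix V V ℝ} (hA : A ∈ Matrix.rowStochastic ℝ V) (x : V) :
    A x ∈ stdSimplex ℝ V :=
  ⟨fun _ => Matrix.nonneg_of_mem_rowStochastic hA, Matrix.sum_row_of_mem_rowStochastic hA x⟩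

end TransitionProd

section Contraction

variable {V : Type*} [Fintype V] [DecidableEq V] {A : Matrix V V ℝ}

lemma iInf_le_mulVec (hA : A ∈ Matrix.rowStochastic ℝ V) (f : V → ℝ) (x : V) :
    ⨅ y, f y ≤ A.mulVec f x :=
  calc ⨅ y, f y = ∑ y, A x y * ⨅ z, f z := by
        rw [← Finset.sum_mul, Matrix.sum_row_of_mem_rowStochastic hA, one_mul]
    _ ≤ A.mulVec f x := Finset.sum_le_sum fun y _ => mul_le_mul_of_nonneg_left
        (ciInf_le (Set.finite_range f).bddBelow y) (Matrix.nonneg_of_mem_rowStochastic hA)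

lemma mulVec_le_iSup_sub [Nonempty V] (hA : A ∈ Matrix.rowStochastic ℝ V) {ε : ℝ}
    (hε : ∀ x y, ε ≤ A x y) (f : V → ℝ) (x : V) :
    A.mulVec f x ≤ (⨆ y, f y) - ε * ((⨆ y, f y) - ⨅ y, f y) := by
  obtain ⟨z, hz⟩ := exists_eq_ciInf_of_finite (f := f)
  have hgap : ∀ y, 0 ≤ (⨆ y, f y) - f y := fun y =>
    sub_nonneg.2 (le_ciSup (Set.finite_range f).bddAbove y)
  have hdeficit : ε * ((⨆ y, f y) - f z) ≤ ∑ y, A x y * ((⨆ y, f y) - f y) :=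
    (mul_le_mul_of_nonneg_right (hε x z) (hgap z)).trans <|
      Finset.single_le_sum (f := fun y => A x y * ((⨆ y, f y) - f y))
        (fun y _ => mul_nonneg (Matrix.nonneg_of_mem_rowStochastic hA) (hgap y))
        (Finset.mem_univ z)
  simp_rw [mul_sub, Finset.sum_sub_distrib, ← Finset.sum_mul,
    Matrix.sum_row_of_mem_rowStochastic hA, one_mul] at hdeficit
  rw [← hz, mul_sub]
  exact le_sub_comm.1 hdeficit

lemma mulVec_le_iSup [Nonempty V] (hA : A ∈ Matrix.rowStochastic ℝ V) (f : V → ℝ) (x : V) :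
    A.mulVec f x ≤ ⨆ y, f y := by
  simpa using mulVec_le_iSup_sub hA (fun _ _ => Matrix.nonneg_of_mem_rowStochastic hA) f x

lemma exists_tendsto_of_frequently_pos [Nonempty V] {Q : ℕ → Matrix V V ℝ} {f : ℕ → V → ℝ}
    (hQ : ∀ k, Q k ∈ Matrix.rowStochastic ℝ V) (hf : ∀ k, f (k + 1) = (Q k).mulVec (f k))
    {ε : ℝ} (hε : 0 < ε) (hpos : ∃ᶠ k in atTop, ∀ x y, ε ≤ Q k x y) :
    ∃ c, ∀ x, Tendsto (fun k => f k x) atTop (𝓝 c) := by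
  have hle : ∀ k x, f k x ≤ ⨆ y, f k y := fun k => le_ciSup (Set.finite_range _).bddAbove
  have hge : ∀ k x, ⨅ y, f k y ≤ f k x := fun k => ciInf_le (Set.finite_range _).bddBelow
  have hanti : Antitone fun k => ⨆ y, f k y := antitone_nat_of_succ_le fun k =>
    ciSup_le fun x => hf k ▸ mulVec_le_iSup (hQ k) _ x
  have hmono : Monotone fun k => ⨅ y, f k y := monotone_nat_of_le_succ fun k =>
    le_ciInf fun x => hf k ▸ iInf_le_mulVec (hQ k) _ x
  have hmax : Tendsto (fun k => ⨆ y, f k y) atTop (𝓝 (⨅ k, ⨆ y, f k y)) := by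
    refine tendsto_atTop_ciInf hanti ⟨⨅ y, f 0 y, ?_⟩
    rintro _ ⟨k, rfl⟩
    obtain ⟨x⟩ := ‹Nonempty V›
    exact (hmono k.zero_le).trans ((hge k x).trans (hle k x))
  have hmin : Tendsto (fun k => ⨅ y, f k y) atTop (𝓝 (⨆ k, ⨅ y, f k y)) := by
    refine tendsto_atTop_ciSup hmono ⟨⨆ y, f 0 y, ?_⟩
    rintro _ ⟨k, rfl⟩
    obtain ⟨x⟩ := ‹Nonempty V›
    exact ((hge k x).trans (hle k x)).trans (hanti k.zero_le)
  set M := ⨅ k, ⨆ y, f k y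
  set m := ⨆ k, ⨅ y, f k y
  have hcontract : M ≤ M - ε * (M - m) :=
    le_of_tendsto_of_tendsto_of_frequently ((tendsto_add_atTop_iff_nat 1).2 hmax)
      (hmax.sub ((hmax.sub hmin).const_mul ε))
      (hpos.mono fun k hk => ciSup_le fun x => hf k ▸ mulVec_le_iSup_sub (hQ k) hk _ x)
  have hmM : m = M := by
    refine le_antisymm ?_ (by nlinarith)
    obtain ⟨x⟩ := ‹Nonempty V›
    exact le_of_tendsto_of_tendsto' hmin hmax fun k => (hge k x).trans (hle k x)
  exact ⟨M, fun x => tendsto_of_tendsto_of_tendsto_of_le_of_le (hmM ▸ hmin) hmax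
    (fun k => hge k x) fun k => hle k x⟩

end Contraction

section Target

variable {V : Type*} [Fintype V] [DecidableEq V] {P : ℤ → Matrix V V ℝ} {t : ℤ}

lemma map_sub_natCast_atTop (t : ℤ) : map (fun k : ℕ => t - (k : ℤ)) atTop = atBot := by
  calc map (fun k : ℕ => t - (k : ℤ)) atTop
      = map (fun u : ℤ => t - u) (map Nat.cast (atTop : Filter ℕ)) := Filter.map_map.symm
    _ = map (fun u : ℤ => t - u) atTop := by rw [Nat.map_cast_int_atTop]
    _ = atBot := (OrderIso.subLeft t).map_atTop

lemma targetExists_of_frequently_pos [Nonempty V] (hP : ∀ u, P u ∈ Matrix.rowStochastic ℝ V)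
    {ε : ℝ} (hε : 0 < ε) (hpos : ∃ᶠ u in atBot, ∀ x y, ε ≤ P u x y) (t : ℤ) :
    TargetExists P t := by
  have hcolumn : ∀ y, ∃ c, ∀ x,
      Tendsto (fun k : ℕ => transitionProd P (t - k) t x y) atTop (𝓝 c) := fun y => by
    refine exists_tendsto_of_frequently_pos (Q := fun k => P (t - k))
      (f := fun k x => transitionProd P (t - k) t x y) (fun k => hP _) (fun k => ?_) hε ?_
    · have hpred : t - ((k + 1 : ℕ) : ℤ) = t - k - 1 := by push_cast; ring
      rw [hpred, transitionProd_pred_left P (by omega)]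
      rfl
    · rwa [← map_sub_natCast_atTop t, frequently_map] at hpos
  choose μ hμ using hcolumn
  refine ⟨μ, fun x y => ?_⟩
  rw [← map_sub_natCast_atTop t, tendsto_map'_iff]
  exact hμ y x

lemma isTarget_target (h : TargetExists P t) : IsTarget P t (target P t) := by
  rw [target, dif_pos h]
  exact h.choose_spec

lemma sum_target [Nonempty V] (hP : ∀ u, P u ∈ Matrix.rowStochastic ℝ V)
    (h : TargetExists P t) : ∑ y, target P t y = 1 := by
  obtain ⟨x⟩ := ‹Nonempty V›
  have hsum := tendsto_finsetSum Finset.univ fun y _ => isTarget_target h x y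
  simp_rw [Matrix.sum_row_of_mem_rowStochastic (transitionProd_mem_rowStochastic hP _ _)] at hsum
  exact tendsto_nhds_unique hsum tendsto_const_nhds

lemma target_mem_Icc_of_frequently (h : TargetExists P t) {x : V} {a b : ℝ}
    (hrow : ∃ᶠ s in atBot, ∀ y, transitionProd P s t x y ∈ Set.Icc a b) (y : V) :
    target P t y ∈ Set.Icc a b :=
  isClosed_Icc.mem_of_frequently_of_tendsto (hrow.mono fun _ hs => hs y) (isTarget_target h x y)

end Target

section DeterministicBounds

open scoped Finset

variable {V : Type*} [Fintype V] [DecidableEq V] {P : ℤ → Matrix V V ℝ} {t : ℤ} {a b : ℝ}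

lemma targetMass_add_targetMass_compl (hsum : ∑ x, target P t x = 1) (S : Finset V) :
    targetMass P t S + targetMass P t Sᶜ = 1 :=
  (Finset.sum_add_sum_compl S _).trans hsum

lemma targetMass_le_card_mul (hπ : ∀ x, target P t x ≤ b) (S : Finset V) :
    targetMass P t S ≤ #S * b :=
  (Finset.sum_le_card_nsmul S _ b fun x _ => hπ x).trans_eq (nsmul_eq_mul _ _)

lemma mul_card_interedges_le_flow (hP : ∀ x y, 0 ≤ P t x y) (ha : 0 ≤ a)
    (hπ : ∀ x, a ≤ target P (t - 1) x) {G : SimpleGraph V} [DecidableRel G.Adj] {q : ℝ}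
    (hq0 : 0 ≤ q) (hq : ∀ x y, G.Adj x y → q ≤ P t x y) (S T : Finset V) :
    a * q * #(G.interedges S T) ≤ flow P t S T := by
  calc a * q * #(G.interedges S T)
      = ∑ _e ∈ G.interedges S T, a * q := by rw [Finset.sum_const, nsmul_eq_mul, mul_comm]
    _ ≤ ∑ e ∈ G.interedges S T, target P (t - 1) e.1 * P t e.1 e.2 :=
      Finset.sum_le_sum fun e he => mul_le_mul (hπ e.1)
        (hq _ _ (G.mem_interedges_iff.1 he).2.2) hq0 (ha.trans (hπ e.1))
    _ ≤ ∑ e ∈ S ×ˢ T, target P (t - 1) e.1 * P t e.1 e.2 :=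
      Finset.sum_le_sum_of_subset_of_nonneg (Finset.filter_subset _ _)
        fun e _ _ => mul_nonneg (ha.trans (hπ _)) (hP _ _)
    _ = flow P t S T := Finset.sum_product_right _ _ _

lemma card_interedges_compl_comm (G : SimpleGraph V) [DecidableRel G.Adj] (S : Finset V) :
    #(G.interedges Sᶜ S) = #(G.interedges S Sᶜ) :=
  have := G.symm
  Rel.card_interedges_comm _ _

lemma mul_targetMass_le_card_interedges {G : SimpleGraph V} [DecidableRel G.Adj] {h : ℝ}
    (hh : 0 ≤ h)
    (hexp : ∀ S : Finset V, 2 * #S ≤ Fintype.card V → h * #S ≤ #(G.interedges S Sᶜ))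
    (hb : 0 < b) (hπ : ∀ x, target P t x ≤ b) (hsum : ∑ x, target P t x = 1)
    {S : Finset V} (hS : targetMass P t S ≤ 1 / 2) :
    h / b * targetMass P t S ≤ #(G.interedges S Sᶜ) := by
  have of_side : ∀ T : Finset V, targetMass P t S ≤ targetMass P t T →
      2 * #T ≤ Fintype.card V → h / b * targetMass P t S ≤ #(G.interedges T Tᶜ) :=
    fun T hST hT => calc
      h / b * targetMass P t S ≤ h / b * (#T * b) :=
        mul_le_mul_of_nonneg_left (hST.trans (targetMass_le_card_mul hπ T)) (by positivity)
      _ = h * #T := by field_simp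
      _ ≤ #(G.interedges T Tᶜ) := hexp T hT
  by_cases hcard : 2 * #S ≤ Fintype.card V
  · exact of_side S le_rfl hcard
  · rw [← card_interedges_compl_comm]
    have hcompl := targetMass_add_targetMass_compl hsum S
    simpa only [compl_compl] using
      of_side Sᶜ (by linarith) (by rw [Finset.card_compl]; omega)

lemma le_bottleneckRatio [Nonempty V] (hP : ∀ x y, 0 ≤ P t x y) (ha : 0 < a) (hb : b ≤ 1 / 2)
    (hπ : ∀ x, target P (t - 1) x ∈ Set.Icc a b) (hsum : ∑ x, target P (t - 1) x = 1)
    {G : SimpleGraph V} [DecidableRel G.Adj] {q h : ℝ} (hq0 : 0 ≤ q)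
    (hq : ∀ x y, G.Adj x y → q ≤ P t x y) (hh : 0 ≤ h)
    (hexp : ∀ S : Finset V, 2 * #S ≤ Fintype.card V → h * #S ≤ #(G.interedges S Sᶜ)) :
    a * q * h / b ≤ bottleneckRatio P t := by
  obtain ⟨x₀⟩ := ‹Nonempty V›
  have hb0 : 0 < b := ha.trans_le ((hπ x₀).1.trans (hπ x₀).2)
  refine le_csInf ⟨_, {x₀}, Finset.singleton_nonempty _, ?_, rfl⟩ ?_
  · simpa only [targetMass, Finset.sum_singleton] using (hπ x₀).2.trans hb
  rintro _ ⟨S, hS, hmass, rfl⟩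
  have hpos : 0 < targetMass P (t - 1) S := Finset.sum_pos (fun x _ => ha.trans_le (hπ x).1) hS
  have hflow := mul_card_interedges_le_flow hP ha.le (fun x => (hπ x).1) hq0 hq S Sᶜ
  have hflow' := mul_card_interedges_le_flow hP ha.le (fun x => (hπ x).1) hq0 hq Sᶜ S
  rw [card_interedges_compl_comm] at hflow'
  have hcut := mul_le_mul_of_nonneg_left
    (mul_targetMass_le_card_interedges hh hexp hb0 (fun x => (hπ x).2) hsum hmass)
    (mul_nonneg ha.le hq0)
  rw [bottleneck, one_div, ← div_eq_inv_mul, le_div_iff₀ (by positivity)]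
  calc a * q * h / b * (2 * targetMass P (t - 1) S)
      = 2 * (a * q * (h / b * targetMass P (t - 1) S)) := by ring
    _ ≤ flow P t S Sᶜ + flow P t Sᶜ S := by linarith

lemma changeRate_mem_Icc [Nonempty V] (ha : 0 < a)
    (hπ' : ∀ x, target P (t - 1) x ∈ Set.Icc a b) (hπ : ∀ x, target P t x ∈ Set.Icc a b)
    (hsum' : ∑ x, target P (t - 1) x = 1) (hsum : ∑ x, target P t x = 1) :
    changeRate P t ∈ Set.Icc (a / b) 1 := by
  refine ⟨le_ciInf fun z => div_le_div₀ (ha.le.trans (hπ' z).1) (hπ' z).1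
    (ha.trans_le (hπ z).1) (hπ z).2, ?_⟩
  obtain ⟨z, -, hz⟩ := Finset.exists_le_of_sum_le (s := Finset.univ) Finset.univ_nonempty
    (hsum'.trans hsum.symm).le
  exact (ciInf_le (Set.finite_range _).bddBelow z).trans
    (div_le_one_of_le₀ hz (ha.le.trans (hπ z).1))

lemma div_two_mul_sub_le {g : ℝ} (hb : 0 < b) (hg : g ∈ Set.Icc (a / b) 1) :
    a / (2 * b - a) ≤ 1 / 2 * (g / (1 - 1 / 2 * g)) := by
  obtain ⟨hag, hg1⟩ := hg
  rw [div_le_iff₀ hb] at hag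
  have hg2 : 0 < 1 - 1 / 2 * g := by linarith
  rw [← mul_div_assoc, div_le_div_iff₀ (by nlinarith) hg2]
  linarith

lemma sq_le_Theta [Nonempty V] (hP : ∀ u, P u ∈ Matrix.rowStochastic ℝ V)
    (hex : ∀ u, TargetExists P u) (ha : 0 < a)
    (hπ : ∀ u ∈ Set.Icc 0 t, ∀ x, target P u x ∈ Set.Icc a b) {φ : ℝ} (hφ0 : 0 ≤ φ)
    (hφ : ∀ s ∈ Set.Icc 1 t, φ ≤ bottleneckRatio P s) {c : ℝ} (hc0 : 0 ≤ c)
    (hc : c ≤ a / (2 * b - a) * φ) : ((c ^ 2 : ℝ) : EReal) ≤ Theta P t := by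
  refine le_iInf₂ fun s hs => EReal.coe_le_coe_iff.2 (pow_le_pow_left₀ hc0 (hc.trans ?_) 2)
  have hπ' := hπ (s - 1) ⟨by linarith [hs.1], by linarith [hs.2]⟩
  have hg := changeRate_mem_Icc ha hπ' (hπ s ⟨by linarith [hs.1], hs.2⟩) (sum_target hP (hex _))
    (sum_target hP (hex _))
  obtain ⟨x⟩ := ‹Nonempty V›
  have hb : 0 < b := ha.trans_le ((hπ' x).1.trans (hπ' x).2)
  refine mul_le_mul (div_two_mul_sub_le hb hg) (hφ s hs) hφ0 ?_
  have hg0 := (div_pos ha hb).trans_le hg.1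
  have hg1 : 0 < 1 - 1 / 2 * changeRate P s := by linarith [hg.2]
  positivity

end DeterministicBounds

section LazyWalk

open scoped Classical

variable {V : Type*} [Fintype V] {G : SimpleGraph V}

lemma lazyWalk_apply_of_adj {x y : V} (h : G.Adj x y) :
    lazyWalk G x y = 1 / (2 * G.degree x) := by
  simp only [lazyWalk, Matrix.of_apply, if_neg h.ne, if_pos h]

lemma lazyWalk_nonneg (G : SimpleGraph V) (x y : V) : 0 ≤ lazyWalk G x y := by
  simp only [lazyWalk, Matrix.of_apply]
  split_ifs <;> positivity

lemma lazyWalk_apply (G : SimpleGraph V) (x y : V) : lazyWalk G x y =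
    (if x = y then (if 1 ≤ G.degree x then 1 / 2 else 1) else 0) +
      if G.Adj x y then 1 / (2 * (G.degree x : ℝ)) else 0 := by
  by_cases h : x = y
  · subst h
    simp [lazyWalk]
  · simp [lazyWalk, h]

lemma lazyWalk_mem_rowStochastic (G : SimpleGraph V) :
    lazyWalk G ∈ Matrix.rowStochastic ℝ V := by
  refine Matrix.mem_rowStochastic_iff_sum.2 ⟨lazyWalk_nonneg G, fun x => ?_⟩
  simp_rw [lazyWalk_apply, Finset.sum_add_distrib, Finset.sum_ite_eq, ← Finset.sum_filter,
    Finset.sum_const, ← G.neighborFinset_eq_filter, G.card_neighborFinset_eq_degree]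
  by_cases hx : 1 ≤ G.degree x
  · have hx' : (G.degree x : ℝ) ≠ 0 := by positivity
    simp only [Finset.mem_univ, if_true, if_pos hx, nsmul_eq_mul]
    field_simp
    norm_num
  · simp [Nat.lt_one_iff.1 (not_le.1 hx)]

lemma le_lazyWalk_of_eq_or_adj {x y : V} (h : x = y ∨ G.Adj x y) :
    1 / (2 * (Fintype.card V : ℝ)) ≤ lazyWalk G x y := by
  have hcard : (1 : ℝ) ≤ Fintype.card V := by exact_mod_cast Fintype.card_pos_iff.2 ⟨x⟩
  rcases h with rfl | hadj
  · have hhalf : 1 / (2 * (Fintype.card V : ℝ)) ≤ 1 / 2 :=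
      one_div_le_one_div_of_le (by norm_num) (by linarith)
    simp only [lazyWalk, Matrix.of_apply, if_true]
    split_ifs <;> linarith
  · have hdeg : (G.degree x : ℝ) ≤ Fintype.card V := by
      exact_mod_cast (G.degree_lt_card_verts x).le
    have hdeg0 : (0 : ℝ) < G.degree x := by
      exact_mod_cast (G.degree_pos_iff_exists_adj x).2 ⟨y, hadj⟩
    rw [lazyWalk_apply_of_adj hadj]
    exact one_div_le_one_div_of_le (by positivity) (by linarith)

lemma vecMul_lazyWalk_apply (ν : V → ℝ) {y : V} (hy : 1 ≤ G.degree y) :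
    Matrix.vecMul ν (lazyWalk G) y = (ν y + ∑ x ∈ G.neighborFinset y, ν x / G.degree x) / 2 := by
  simp only [Matrix.vecMul, dotProduct, lazyWalk_apply, mul_add, Finset.sum_add_distrib, mul_ite,
    mul_zero, Finset.sum_ite_eq', Finset.mem_univ, if_true, if_pos hy, G.adj_comm _ y,
    G.neighborFinset_eq_filter, Finset.sum_filter, add_div, Finset.sum_div]
  congr 1
  · ring
  · refine Finset.sum_congr rfl fun x _ => ?_
    split_ifs <;> ring

lemma vecMul_lazyWalk_le {ν : V → ℝ} (hν : 0 ≤ ν) {d : ℝ} (hd : 0 < d)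
    (hdeg : ∀ x, d ≤ G.degree x) (y : V) :
    Matrix.vecMul ν (lazyWalk G) y ≤ (ν y + (∑ x ∈ G.neighborFinset y, ν x) / d) / 2 := by
  rw [vecMul_lazyWalk_apply ν (Nat.cast_pos.1 (hd.trans_le (hdeg y))), Finset.sum_div]
  gcongr with x
  · exact hν x
  · exact hdeg x

lemma le_vecMul_lazyWalk {ν : V → ℝ} (hν : 0 ≤ ν) {D : ℝ}
    (hdeg : ∀ x, 1 ≤ G.degree x ∧ G.degree x ≤ D) (y : V) :
    (∑ x ∈ G.neighborFinset y, ν x) / (2 * D) ≤ Matrix.vecMul ν (lazyWalk G) y := by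
  have hshare : (∑ x ∈ G.neighborFinset y, ν x) / D ≤
      ∑ x ∈ G.neighborFinset y, ν x / G.degree x := by
    rw [Finset.sum_div]
    gcongr with x
    · exact hν x
    · exact Nat.cast_pos.2 (hdeg x).1
    · exact (hdeg x).2
  rw [vecMul_lazyWalk_apply ν (hdeg y).1, mul_comm, ← div_div]
  linarith [show 0 ≤ ν y from hν y]

end LazyWalk

section GoodGraphs

open scoped Finset Classical

variable {V : Type*} [Fintype V] {L : ℝ} {ν : V → ℝ} {G : SimpleGraph V}

/-- All degrees of `G` are of order `L`, and every set of at most half of the vertices has an edge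
boundary of order `L` times its size. In a binomial random graph `L` is the mean degree. -/
structure IsNearRegularExpander (L : ℝ) (G : SimpleGraph V) : Prop where
  half_le_degree : ∀ x, L / 2 ≤ G.degree x
  degree_le : ∀ x, G.degree x ≤ 2 * L
  expansion : ∀ S : Finset V, 2 * #S ≤ Fintype.card V → L / 10 * #S ≤ #(G.interedges S Sᶜ)

/-- The neighbourhoods of `G` see the mass distribution `ν` almost as evenly as their size of order
`L` allows. The upper bound is relative to any bound `b ≥ 7 / |V|` on `ν`; the lower bound is
required once `ν` is as flat as `7 / |V|`. -/
structure SpreadsMass (L : ℝ) (ν : V → ℝ) (G : SimpleGraph V) : Prop where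
  sum_le : ∀ b : ℝ, 7 / Fintype.card V ≤ b → (∀ x, ν x ≤ b) →
    ∀ y, ∑ x ∈ G.neighborFinset y, ν x ≤ 0.4 * L * b
  le_sum : (∀ x, ν x ≤ 7 / Fintype.card V) →
    ∀ y, 0.14 * L / Fintype.card V ≤ ∑ x ∈ G.neighborFinset y, ν x

lemma IsNearRegularExpander.one_le_degree (hL : 0 < L) (hG : IsNearRegularExpander L G) (x : V) :
    1 ≤ G.degree x :=
  Nat.cast_pos.1 ((half_pos hL).trans_le (hG.half_le_degree x))

lemma IsNearRegularExpander.vecMul_lazyWalk_le (hL : 0 < L) (hG : IsNearRegularExpander L G)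
    (hν : 0 ≤ ν) (hspread : SpreadsMass L ν G) {b : ℝ} (hb : 7 / Fintype.card V ≤ b)
    (hνb : ∀ x, ν x ≤ b) (y : V) : Matrix.vecMul ν (lazyWalk G) y ≤ 0.9 * b :=
  calc Matrix.vecMul ν (lazyWalk G) y
      ≤ (ν y + (∑ x ∈ G.neighborFinset y, ν x) / (L / 2)) / 2 :=
        DynamicGraph.vecMul_lazyWalk_le hν (half_pos hL) hG.half_le_degree y
    _ ≤ (b + 0.4 * L * b / (L / 2)) / 2 := by
        gcongr
        exacts [hνb y, hspread.sum_le b hb hνb y]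
    _ = 0.9 * b := by field_simp; ring

lemma IsNearRegularExpander.le_vecMul_lazyWalk (hL : 0 < L) (hG : IsNearRegularExpander L G)
    (hν : 0 ≤ ν) (hspread : SpreadsMass L ν G) (hflat : ∀ x, ν x ≤ 7 / Fintype.card V) (y : V) :
    0.035 / Fintype.card V ≤ Matrix.vecMul ν (lazyWalk G) y :=
  calc 0.035 / (Fintype.card V : ℝ) = 0.14 * L / Fintype.card V / (2 * (2 * L)) := by
        field_simp; norm_num
    _ ≤ (∑ x ∈ G.neighborFinset y, ν x) / (2 * (2 * L)) := by
        gcongr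
        exact hspread.le_sum hflat y
    _ ≤ Matrix.vecMul ν (lazyWalk G) y :=
        DynamicGraph.le_vecMul_lazyWalk hν (fun x => ⟨hG.one_le_degree hL x, hG.degree_le x⟩) y

lemma IsNearRegularExpander.le_bottleneckRatio [Nonempty V] {G : ℤ → SimpleGraph V} {t : ℤ}
    (hL : 0 < L) (hG : IsNearRegularExpander L (G t))
    (hex : TargetExists (fun u => lazyWalk (G u)) (t - 1)) {a b : ℝ} (ha : 0 < a)
    (hb : b ≤ 1 / 2) (hπ : ∀ x, target (fun u => lazyWalk (G u)) (t - 1) x ∈ Set.Icc a b) :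
    a / (40 * b) ≤ bottleneckRatio (fun u => lazyWalk (G u)) t := by
  have hstep : ∀ x y, (G t).Adj x y → 1 / (2 * (2 * L)) ≤ lazyWalk (G t) x y := fun x y h => by
    have hdeg : (1 : ℝ) ≤ (G t).degree x := by exact_mod_cast hG.one_le_degree hL x
    rw [lazyWalk_apply_of_adj h]
    exact one_div_le_one_div_of_le (by positivity) (by linarith [hG.degree_le x])
  calc a / (40 * b) = a * (1 / (2 * (2 * L))) * (L / 10) / b := by
        field_simp
        norm_num
    _ ≤ _ := DynamicGraph.le_bottleneckRatio (lazyWalk_nonneg (G t)) ha hb hπ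
        (sum_target (fun u => lazyWalk_mem_rowStochastic (G u)) hex) (by positivity) hstep
        (by positivity) hG.expansion

end GoodGraphs

section EdgeSums

open ProbabilityTheory unitInterval
open scoped Classical

lemma iIndepFun_map_iff {Ω Ω' ι : Type*} [MeasurableSpace Ω] [MeasurableSpace Ω'] {E : ι → Type*}
    [∀ i, MeasurableSpace (E i)] {μ : Measure Ω} [IsProbabilityMeasure μ] {g : Ω → Ω'}
    (hg : Measurable g) {f : ∀ i, Ω' → E i} (hf : ∀ i, Measurable (f i)) :
    iIndepFun f (μ.map g) ↔ iIndepFun (fun i => f i ∘ g) μ := by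
  have := Measure.isProbabilityMeasure_map (μ := μ) hg.aemeasurable
  rw [iIndepFun_iff_map_fun_eq_infinitePi_map hf,
    iIndepFun_iff_map_fun_eq_infinitePi_map fun i => (hf i).comp hg,
    Measure.map_map (measurable_pi_lambda _ hf) hg]
  simp_rw [Measure.map_map (hf _) hg]
  rfl

instance {V : Type*} [Finite V] : MeasurableSingletonClass (SimpleGraph V) where
  measurableSet_singleton G := by
    have hpreimage : ({G} : Set (SimpleGraph V)) = SimpleGraph.edgeSet ⁻¹' {G.edgeSet} := by
      ext H
      simp
    rw [hpreimage]
    exact SimpleGraph.measurable_edgeSet (measurableSet_singleton _)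

variable {V : Type*} [Finite V]

lemma binomialRandom_eq_map_infinitePi (p : I) :
    SimpleGraph.binomialRandom V p =
      (Measure.infinitePi fun e : Sym2 V => (toNNReal p • .dirac (e ∈ Sym2.diagSetᶜ) +
        toNNReal (σ p) • .dirac False : Measure Prop)).map
      fun ω => SimpleGraph.fromEdgeSet {e | ω e} := by
  have hm : Measurable (fun S : Set (Sym2 V) => SimpleGraph.fromEdgeSet S) := by fun_prop
  rw [SimpleGraph.binomialRandom_eq_map, setBernoulli_eq_map, Measure.map_map hm (by fun_prop)]
  rfl

lemma iIndepFun_mem_edgeSet (p : I) :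
    iIndepFun (fun (e : Sym2 V) (G : SimpleGraph V) => e ∈ G.edgeSet)
      (SimpleGraph.binomialRandom V p) := by
  rw [binomialRandom_eq_map_infinitePi,
    iIndepFun_map_iff (by fun_prop) fun _ => measurable_of_finite _]
  simp only [Function.comp_def, SimpleGraph.edgeSet_fromEdgeSet]
  exact iIndepFun_infinitePi (X := fun e b => b ∧ e ∉ Sym2.diagSet) fun _ => measurable_of_finite _

lemma binomialRandom_mem_edgeSet (p : I) {e : Sym2 V} (he : ¬ e.IsDiag) :
    (SimpleGraph.binomialRandom V p).real {G | e ∈ G.edgeSet} = p := by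
  have hpreimage : (fun ω : Sym2 V → Prop => SimpleGraph.fromEdgeSet {e | ω e}) ⁻¹'
      {G | e ∈ G.edgeSet} = Function.eval e ⁻¹' {b | b} := by
    ext ω
    simp [he]
  rw [binomialRandom_eq_map_infinitePi, map_measureReal_apply (by fun_prop)
    (Set.toFinite _).measurableSet, hpreimage,
    (measurePreserving_eval_infinitePi _ e).measureReal_preimage
    (Set.toFinite _).measurableSet.nullMeasurableSet]
  simp [measureReal_def, he]

lemma exp_mul_sub_one_le (c : ℝ) {w : ℝ} (hw : w ∈ Set.Icc 0 1) :
    Real.exp (c * w) - 1 ≤ (Real.exp c - 1) * w := by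
  have hchord := convexOn_exp.2 (Set.mem_univ 0) (Set.mem_univ c) (sub_nonneg.2 hw.2) hw.1
    (by ring)
  simp only [smul_eq_mul, mul_zero, zero_add, Real.exp_zero, mul_comm w c] at hchord
  linarith

lemma mgf_edge_le (p : I) {e : Sym2 V} (he : ¬ e.IsDiag) (c : ℝ) {w : ℝ} (hw : w ∈ Set.Icc 0 1) :
    mgf (fun G : SimpleGraph V => if e ∈ G.edgeSet then w else 0)
      (SimpleGraph.binomialRandom V p) c ≤ Real.exp ((Real.exp c - 1) * (p * w)) := by
  have hsplit : ∀ G : SimpleGraph V, Real.exp (c * if e ∈ G.edgeSet then w else 0) =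
      1 + {G : SimpleGraph V | e ∈ G.edgeSet}.indicator (fun _ => Real.exp (c * w) - 1) G :=
    fun G => by by_cases h : e ∈ G.edgeSet <;> simp [h]
  calc mgf (fun G : SimpleGraph V => if e ∈ G.edgeSet then w else 0)
        (SimpleGraph.binomialRandom V p) c
      = 1 + p * (Real.exp (c * w) - 1) := by
        simp_rw [mgf, hsplit]
        rw [integral_add .of_finite .of_finite,
          integral_indicator_const _ (Set.toFinite _).measurableSet,
          binomialRandom_mem_edgeSet p he]
        simp
    _ ≤ (Real.exp c - 1) * (p * w) + 1 := by
        have := mul_le_mul_of_nonneg_left (exp_mul_sub_one_le c hw) p.2.1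
        linarith
    _ ≤ Real.exp ((Real.exp c - 1) * (p * w)) := Real.add_one_le_exp _

variable {ι : Type*} {S : Finset ι} {e : ι → Sym2 V} {w : ι → ℝ}

lemma mgf_sum_edges_le (p : I) (he : Set.InjOn e S) (hdiag : ∀ i ∈ S, ¬ (e i).IsDiag)
    (hw : ∀ i ∈ S, w i ∈ Set.Icc 0 1) (c : ℝ) :
    mgf (fun G : SimpleGraph V => ∑ i ∈ S with e i ∈ G.edgeSet, w i)
      (SimpleGraph.binomialRandom V p) c ≤ Real.exp ((Real.exp c - 1) * (p * ∑ i ∈ S, w i)) := by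
  have hinj : Function.Injective fun i : S => e i := fun i j h => Subtype.ext (he i.2 j.2 h)
  have hindep : iIndepFun
      (fun (i : S) (G : SimpleGraph V) => if e i ∈ G.edgeSet then w i else 0)
      (SimpleGraph.binomialRandom V p) := by
    convert ((iIndepFun_mem_edgeSet p).precomp hinj).comp
      (fun i b => if b then w i else 0) fun _ => measurable_of_finite _ using 1
    ext i G
    simp only [Function.comp_apply]
    congr
  have hsum : (fun G : SimpleGraph V => ∑ i ∈ S with e i ∈ G.edgeSet, w i) =
      ∑ i : S, fun G : SimpleGraph V => if e i ∈ G.edgeSet then w i else 0 := by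
    ext G
    rw [Finset.sum_filter, ← Finset.sum_coe_sort, Finset.sum_apply]
  rw [hsum, hindep.mgf_sum (fun _ => measurable_of_finite _), ← Finset.sum_coe_sort S,
    Finset.mul_sum, Finset.mul_sum, Real.exp_sum]
  exact Finset.prod_le_prod (fun _ _ => mgf_nonneg) fun i _ =>
    mgf_edge_le p (hdiag i i.2) c (hw i i.2)

lemma measureReal_le_sum_edges (p : I) (he : Set.InjOn e S) (hdiag : ∀ i ∈ S, ¬ (e i).IsDiag)
    {b : ℝ} (hb : 0 < b) (hw : ∀ i ∈ S, w i ∈ Set.Icc 0 b) (a : ℝ) :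
    (SimpleGraph.binomialRandom V p).real {G | a * b ≤ ∑ i ∈ S with e i ∈ G.edgeSet, w i} ≤
      Real.exp (1.72 * (p * ((∑ i ∈ S, w i) / b)) - a) := by
  have hwb : ∀ i ∈ S, w i / b ∈ Set.Icc 0 1 := fun i hi => by
    simpa [div_le_one hb, le_div_iff₀ hb] using hw i hi
  have hmean : 0 ≤ p * ∑ i ∈ S, w i / b :=
    mul_nonneg p.2.1 (Finset.sum_nonneg fun i hi => (hwb i hi).1)
  simp_rw [← le_div_iff₀ hb, Finset.sum_div]
  refine (measure_ge_le_exp_mul_mgf a zero_le_one .of_finite).trans ?_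
  calc _ ≤ Real.exp (-1 * a) * Real.exp ((Real.exp 1 - 1) * (p * ∑ i ∈ S, w i / b)) := by
        gcongr
        exact mgf_sum_edges_le p he hdiag hwb 1
    _ ≤ Real.exp (1.72 * (p * ∑ i ∈ S, w i / b) - a) := by
        rw [← Real.exp_add, Real.exp_le_exp]
        nlinarith [Real.exp_one_lt_d9]

lemma measureReal_sum_edges_le (p : I) (he : Set.InjOn e S) (hdiag : ∀ i ∈ S, ¬ (e i).IsDiag)
    {b : ℝ} (hb : 0 < b) (hw : ∀ i ∈ S, w i ∈ Set.Icc 0 b) (a : ℝ) :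
    (SimpleGraph.binomialRandom V p).real {G | ∑ i ∈ S with e i ∈ G.edgeSet, w i ≤ a * b} ≤
      Real.exp (a - 0.63 * (p * ((∑ i ∈ S, w i) / b))) := by
  have hwb : ∀ i ∈ S, w i / b ∈ Set.Icc 0 1 := fun i hi => by
    simpa [div_le_one hb, le_div_iff₀ hb] using hw i hi
  have hmean : 0 ≤ p * ∑ i ∈ S, w i / b :=
    mul_nonneg p.2.1 (Finset.sum_nonneg fun i hi => (hwb i hi).1)
  simp_rw [← div_le_iff₀ hb, Finset.sum_div]
  refine (measure_le_le_exp_mul_mgf a (by norm_num : (-1 : ℝ) ≤ 0) .of_finite).trans ?_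
  calc _ ≤ Real.exp (- -1 * a) * Real.exp ((Real.exp (-1) - 1) * (p * ∑ i ∈ S, w i / b)) := by
        gcongr
        exact mgf_sum_edges_le p he hdiag hwb (-1)
    _ ≤ Real.exp (a - 0.63 * (p * ∑ i ∈ S, w i / b)) := by
        rw [← Real.exp_add, Real.exp_le_exp]
        nlinarith [Real.exp_neg_one_lt_d9]

end EdgeSums

section NeighborhoodSums

open unitInterval
open scoped Finset Classical

variable {V : Type*} [Fintype V] {ν : V → ℝ} {b : ℝ}

lemma neighborFinset_eq_filter_erase (G : SimpleGraph V) (y : V) :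
    G.neighborFinset y = {x ∈ Finset.univ.erase y | s(y, x) ∈ G.edgeSet} := by
  ext x
  simpa [eq_comm] using fun h : G.Adj y x => h.ne

lemma injOn_sym2Mk_erase (y : V) : Set.InjOn (fun x => s(y, x)) (Finset.univ.erase y : Finset V) :=
  fun _ _ _ _ h => Sym2.congr_right.1 h

lemma measureReal_le_sum_neighborFinset (p : I) (hb : 0 < b) (hν : ∀ x, ν x ∈ Set.Icc 0 b)
    (y : V) (a : ℝ) :
    (SimpleGraph.binomialRandom V p).real {G | a * b ≤ ∑ x ∈ G.neighborFinset y, ν x} ≤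
      Real.exp (1.72 * (p * ((∑ x, ν x) / b)) - a) := by
  have hp := p.2.1
  simp_rw [neighborFinset_eq_filter_erase]
  refine (measureReal_le_sum_edges p (injOn_sym2Mk_erase y)
    (fun x hx => by simpa [eq_comm] using hx) hb (fun x _ => hν x) a).trans ?_
  gcongr
  · exact fun x _ _ => (hν x).1
  · exact Finset.subset_univ _

lemma measureReal_sum_neighborFinset_le (p : I) (hb : 0 < b) (hν : ∀ x, ν x ∈ Set.Icc 0 b)
    (y : V) (a : ℝ) :
    (SimpleGraph.binomialRandom V p).real {G | ∑ x ∈ G.neighborFinset y, ν x ≤ a * b} ≤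
      Real.exp (a - 0.63 * (p * ((∑ x, ν x) / b - 1))) := by
  have hp := p.2.1
  have hsum : (∑ x, ν x) / b - 1 ≤ (∑ x ∈ Finset.univ.erase y, ν x) / b := by
    rw [← Finset.add_sum_erase _ ν (Finset.mem_univ y), add_div]
    linarith [(div_le_one hb).2 (hν y).2]
  simp_rw [neighborFinset_eq_filter_erase]
  refine (measureReal_sum_edges_le p (injOn_sym2Mk_erase y)
    (fun x hx => by simpa [eq_comm] using hx) hb (fun x _ => hν x) a).trans ?_
  gcongr

lemma measureReal_card_interedges_le (p : I) (S : Finset V) (a : ℝ) :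
    (SimpleGraph.binomialRandom V p).real {G | (#(G.interedges S Sᶜ) : ℝ) ≤ a} ≤
      Real.exp (a - 0.63 * (p * (#S * (Fintype.card V - #S)))) := by
  have hinj : Set.InjOn (fun e : V × V => s(e.1, e.2)) (S ×ˢ Sᶜ : Finset (V × V)) := by
    rintro ⟨x, y⟩ hxy ⟨x', y'⟩ hxy' h
    simp only [Finset.coe_product, Set.mem_prod, Finset.mem_coe, Finset.mem_compl] at hxy hxy'
    rcases Sym2.eq_iff.1 h with ⟨rfl, rfl⟩ | ⟨rfl, rfl⟩
    · rfl
    · exact absurd hxy.1 hxy'.2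
  have hdiag : ∀ e ∈ S ×ˢ Sᶜ, ¬ s(e.1, e.2).IsDiag := fun e he h => by
    rw [Finset.mem_product, Finset.mem_compl] at he
    exact he.2 (Sym2.mk_isDiag_iff.1 h ▸ he.1)
  have htail := measureReal_sum_edges_le p hinj hdiag (w := fun _ => 1) one_pos (by simp) a
  simpa [SimpleGraph.interedges, Rel.interedges, Finset.card_compl,
    Nat.cast_sub (Finset.card_le_univ S)] using htail

end NeighborhoodSums

section BadGraphs

open unitInterval
open scoped Finset Classical

lemma exp_le_one_div_pow {r : ℝ} (hr : 0 < r) {x : ℝ} (k : ℕ) (hx : x ≤ -(k * Real.log r)) :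
    Real.exp x ≤ 1 / r ^ k :=
  calc Real.exp x ≤ Real.exp (-(k * Real.log r)) := Real.exp_le_exp.2 hx
    _ = 1 / r ^ k := by rw [Real.exp_neg, Real.exp_nat_mul, Real.exp_log hr, one_div]

lemma one_le_log {r : ℝ} (hr : 400 ≤ r) : 1 ≤ Real.log r := by
  rw [Real.le_log_iff_exp_le (by linarith)]
  linarith [Real.exp_one_lt_d9]

lemma one_add_pow_sub_one_le {x : ℝ} {n : ℕ} (hx : 0 ≤ x) (hn : n * x ≤ 1) :
    (x + 1) ^ n - 1 ≤ 2 * (n * x) := by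
  have hnx : 0 ≤ n * x := by positivity
  have hexp := Real.abs_exp_sub_one_le ((abs_of_nonneg hnx).trans_le hn)
  rw [abs_of_nonneg hnx] at hexp
  calc (x + 1) ^ n - 1 ≤ Real.exp x ^ n - 1 := by
        gcongr
        exact Real.add_one_le_exp x
    _ = Real.exp (n * x) - 1 := by rw [Real.exp_nat_mul]
    _ ≤ 2 * (n * x) := (le_abs_self _).trans hexp

variable {V : Type*} [Fintype V] (p : I) {L : ℝ}

lemma measureReal_degree_lt (hcard : 400 ≤ Fintype.card V)
    (hL : p * ((Fintype.card V : ℝ) - 1) = L) (hlog : 50 * Real.log (Fintype.card V) ≤ L) (x : V) :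
    (SimpleGraph.binomialRandom V p).real {G | (G.degree x : ℝ) < L / 2} ≤
      1 / (Fintype.card V : ℝ) ^ 3 := by
  have hcard' : (400 : ℝ) ≤ Fintype.card V := by exact_mod_cast hcard
  have htail := measureReal_sum_neighborFinset_le p one_pos (ν := fun _ => 1) (by simp) x (L / 2)
  simp only [Finset.sum_const, nsmul_eq_mul, mul_one, div_one, Finset.card_univ, hL,
    SimpleGraph.card_neighborFinset_eq_degree] at htail
  refine (measureReal_mono fun G hG => (Set.mem_ofPred.1 hG).le).trans
    (htail.trans (exp_le_one_div_pow (by linarith) 3 ?_))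
  push_cast
  linarith [one_le_log hcard']

lemma measureReal_lt_degree (hcard : 400 ≤ Fintype.card V)
    (hL : p * ((Fintype.card V : ℝ) - 1) = L) (hlog : 50 * Real.log (Fintype.card V) ≤ L) (x : V) :
    (SimpleGraph.binomialRandom V p).real {G | 2 * L < G.degree x} ≤
      1 / (Fintype.card V : ℝ) ^ 3 := by
  have hcard' : (400 : ℝ) ≤ Fintype.card V := by exact_mod_cast hcard
  have htail := measureReal_le_sum_neighborFinset p one_pos (ν := fun _ => 1) (by simp) x (2 * L)
  simp only [Finset.sum_const, nsmul_eq_mul, mul_one, div_one, Finset.card_univ,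
    SimpleGraph.card_neighborFinset_eq_degree] at htail
  refine (measureReal_mono fun G hG => (Set.mem_ofPred.1 hG).le).trans
    (htail.trans (exp_le_one_div_pow (by linarith) 3 ?_))
  push_cast
  linarith [one_le_log hcard', p.2.2]

lemma measureReal_card_interedges_lt (hcard : 400 ≤ Fintype.card V)
    (hL : p * ((Fintype.card V : ℝ) - 1) = L) (hlog : 50 * Real.log (Fintype.card V) ≤ L)
    {S : Finset V} (hS : 2 * #S ≤ Fintype.card V) :
    (SimpleGraph.binomialRandom V p).real {G | (#(G.interedges S Sᶜ) : ℝ) < L / 10 * #S} ≤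
      (1 / (Fintype.card V : ℝ) ^ 4) ^ #S := by
  have hcard' : (400 : ℝ) ≤ Fintype.card V := by exact_mod_cast hcard
  have hS' : (2 : ℝ) * #S ≤ Fintype.card V := by exact_mod_cast hS
  refine (measureReal_mono fun G hG => (Set.mem_ofPred.1 hG).le).trans
    ((measureReal_card_interedges_le p S _).trans ?_)
  rw [one_div_pow, ← pow_mul]
  refine exp_le_one_div_pow (by linarith) _ ?_
  have hmean : L / 2 * #S ≤ p * (#S * (Fintype.card V - #S)) := by
    have hL2 : L / 2 ≤ p * (Fintype.card V - #S) := by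
      rw [← hL]
      nlinarith [p.2.1]
    calc L / 2 * #S ≤ p * (Fintype.card V - #S) * #S := by gcongr
      _ = p * (#S * (Fintype.card V - #S)) := by ring
  have hlogS := mul_le_mul_of_nonneg_right hlog (Nat.cast_nonneg #S)
  have hlogS0 : 0 ≤ Real.log (Fintype.card V) * #S :=
    mul_nonneg (by linarith [one_le_log hcard']) (Nat.cast_nonneg _)
  push_cast
  linarith

lemma measureReal_exists_card_interedges_lt (hcard : 400 ≤ Fintype.card V)
    (hL : p * ((Fintype.card V : ℝ) - 1) = L) (hlog : 50 * Real.log (Fintype.card V) ≤ L) :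
    (SimpleGraph.binomialRandom V p).real
      {G | ∃ S : Finset V, 2 * #S ≤ Fintype.card V ∧ (#(G.interedges S Sᶜ) : ℝ) < L / 10 * #S} ≤
      2 / (Fintype.card V : ℝ) ^ 2 := by
  have hcard' : (400 : ℝ) ≤ Fintype.card V := by exact_mod_cast hcard
  set q : ℝ := 1 / (Fintype.card V : ℝ) ^ 4 with hq
  have hcover : {G : SimpleGraph V | ∃ S : Finset V, 2 * #S ≤ Fintype.card V ∧
      (#(G.interedges S Sᶜ) : ℝ) < L / 10 * #S} ⊆
      ⋃ S ∈ {S : Finset V | 2 * #S ≤ Fintype.card V ∧ S ≠ ∅}.toFinset,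
        {G | (#(G.interedges S Sᶜ) : ℝ) < L / 10 * #S} := by
    rintro G ⟨S, hS, hG⟩
    have hne : S ≠ ∅ := by
      rintro rfl
      simp at hG
    exact Set.mem_biUnion (Set.mem_toFinset.2 ⟨hS, hne⟩) hG
  have hNq : Fintype.card V * q ≤ 1 / (Fintype.card V : ℝ) ^ 2 := by
    rw [hq, mul_one_div, div_le_div_iff₀ (by positivity) (by positivity), one_mul, ← pow_succ']
    exact pow_le_pow_right₀ (by linarith) (by norm_num)
  calc _ ≤ ∑ S ∈ {S : Finset V | 2 * #S ≤ Fintype.card V ∧ S ≠ ∅}.toFinset, q ^ #S :=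
        (measureReal_mono hcover (measure_ne_top _ _)).trans <|
          (measureReal_biUnion_finset_le _ _).trans <|
          Finset.sum_le_sum fun S hS =>
            measureReal_card_interedges_lt p hcard hL hlog (Set.mem_toFinset.1 hS).1
    _ ≤ ∑ S ∈ Finset.univ.erase ∅, q ^ #S :=
        Finset.sum_le_sum_of_subset_of_nonneg (fun S hS => by simp_all) fun _ _ _ => by positivity
    _ = (q + 1) ^ Fintype.card V - 1 := by
        rw [← Fintype.sum_pow_mul_eq_add_pow, ← Finset.add_sum_erase _ _ (Finset.mem_univ ∅)]
        simp
    _ ≤ 2 * (Fintype.card V * q) :=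
        one_add_pow_sub_one_le (by positivity) (hNq.trans ((div_le_one (by positivity)).2
          (one_le_pow₀ (by linarith))))
    _ ≤ 2 / (Fintype.card V : ℝ) ^ 2 := by
        rw [← mul_one_div]
        gcongr

lemma measureReal_exists_le_mul {Ω : Type*} [MeasurableSpace Ω] {μ : Measure Ω}
    [IsFiniteMeasure μ] {E : V → Ω → Prop} {c : ℝ} (hE : ∀ x, μ.real {ω | E x ω} ≤ c) :
    μ.real {ω | ∃ x, E x ω} ≤ Fintype.card V * c := by
  rw [Set.ofPred_exists]
  refine (measureReal_iUnion_fintype_le _).trans ?_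
  exact (Finset.sum_le_card_nsmul _ _ c fun x _ => hE x).trans_eq (nsmul_eq_mul _ _)

lemma measureReal_not_isNearRegularExpander (hcard : 400 ≤ Fintype.card V)
    (hL : p * ((Fintype.card V : ℝ) - 1) = L) (hlog : 50 * Real.log (Fintype.card V) ≤ L) :
    (SimpleGraph.binomialRandom V p).real {G | ¬ IsNearRegularExpander L G} ≤
      4 / (Fintype.card V : ℝ) ^ 2 := by
  have hcard0 : (Fintype.card V : ℝ) ≠ 0 := by positivity
  have hcover : {G : SimpleGraph V | ¬ IsNearRegularExpander L G} ⊆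
      {G | ∃ x, (G.degree x : ℝ) < L / 2} ∪ {G | ∃ x, 2 * L < G.degree x} ∪
      {G | ∃ S : Finset V, 2 * #S ≤ Fintype.card V ∧
        (#(G.interedges S Sᶜ) : ℝ) < L / 10 * #S} := by
    intro G hG
    by_contra! hcon
    simp only [Set.mem_union, Set.mem_ofPred_eq, not_or, not_exists, not_and, not_lt] at hcon
    exact hG ⟨hcon.1.1, hcon.1.2, hcon.2⟩
  refine (measureReal_mono hcover).trans <| (measureReal_union_le _ _).trans <|
    (add_le_add ((measureReal_union_le _ _).trans (add_le_add
      (measureReal_exists_le_mul (measureReal_degree_lt p hcard hL hlog))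
      (measureReal_exists_le_mul (measureReal_lt_degree p hcard hL hlog))))
      (measureReal_exists_card_interedges_lt p hcard hL hlog)).trans_eq ?_
  field_simp
  norm_num

variable {ν : V → ℝ}

lemma measureReal_lt_sum_neighborFinset (hcard : 400 ≤ Fintype.card V)
    (hL : p * ((Fintype.card V : ℝ) - 1) = L) (hlog : 50 * Real.log (Fintype.card V) ≤ L)
    (hν : ν ∈ stdSimplex ℝ V) {b : ℝ} (hb : 7 / Fintype.card V ≤ b) (hνb : ∀ x, ν x ≤ b) (y : V) :
    (SimpleGraph.binomialRandom V p).real {G | 0.4 * L * b < ∑ x ∈ G.neighborFinset y, ν x} ≤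
      1 / (Fintype.card V : ℝ) ^ 3 := by
  have hcard' : (400 : ℝ) ≤ Fintype.card V := by exact_mod_cast hcard
  have hb0 : 0 < b := lt_of_lt_of_le (by positivity) hb
  have hmean : p * (1 / b) ≤ 1.01 * L / 7 := by
    have hinv : 1 / b ≤ Fintype.card V / 7 := by
      rw [div_le_div_iff₀ hb0 (by norm_num), one_mul]
      rwa [div_le_iff₀' (by linarith)] at hb
    calc p * (1 / b) ≤ p * (Fintype.card V / 7) := mul_le_mul_of_nonneg_left hinv p.2.1
      _ ≤ 1.01 * L / 7 := by rw [← hL]; nlinarith [p.2.1]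
  have htail := measureReal_le_sum_neighborFinset p hb0 (fun x => ⟨hν.1 x, hνb x⟩) y (0.4 * L)
  rw [hν.2] at htail
  refine (measureReal_mono fun G hG => (Set.mem_ofPred.1 hG).le).trans
    (htail.trans (exp_le_one_div_pow (by linarith) 3 ?_))
  push_cast
  linarith [one_le_log hcard']

lemma measureReal_sum_neighborFinset_lt (hcard : 400 ≤ Fintype.card V)
    (hL : p * ((Fintype.card V : ℝ) - 1) = L) (hlog : 50 * Real.log (Fintype.card V) ≤ L)
    (hν : ν ∈ stdSimplex ℝ V) (hflat : ∀ x, ν x ≤ 7 / Fintype.card V) (y : V) :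
    (SimpleGraph.binomialRandom V p).real
      {G | ∑ x ∈ G.neighborFinset y, ν x < 0.14 * L / Fintype.card V} ≤
      1 / (Fintype.card V : ℝ) ^ 3 := by
  have hcard' : (400 : ℝ) ≤ Fintype.card V := by exact_mod_cast hcard
  have hmean : 0.14 * L ≤ p * (Fintype.card V / 7 - 1) := by
    rw [← hL]
    nlinarith [p.2.1]
  have htail := measureReal_sum_neighborFinset_le p (b := 7 / Fintype.card V) (by positivity)
    (fun x => ⟨hν.1 x, hflat x⟩) y (0.02 * L)
  rw [hν.2, one_div_div, show 0.02 * L * (7 / (Fintype.card V : ℝ)) = 0.14 * L / Fintype.card V by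
    ring] at htail
  refine (measureReal_mono fun G hG => (Set.mem_ofPred.1 hG).le).trans
    (htail.trans (exp_le_one_div_pow (by linarith) 3 ?_))
  push_cast
  linarith [one_le_log hcard']

lemma measureReal_not_spreadsMass (hcard : 400 ≤ Fintype.card V)
    (hL : p * ((Fintype.card V : ℝ) - 1) = L) (hlog : 50 * Real.log (Fintype.card V) ≤ L)
    (hν : ν ∈ stdSimplex ℝ V) :
    (SimpleGraph.binomialRandom V p).real {G | ¬ SpreadsMass L ν G} ≤
      2 / (Fintype.card V : ℝ) ^ 2 := by
  have hcard' : (400 : ℝ) ≤ Fintype.card V := by exact_mod_cast hcard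
  have : Nonempty V := Fintype.card_pos_iff.1 (by omega)
  have hL0 : 0 ≤ L := by linarith [one_le_log hcard']
  set b := max (7 / (Fintype.card V : ℝ)) (⨆ x, ν x)
  have hνb : ∀ x, ν x ≤ b := fun x =>
    (le_ciSup (Set.finite_range ν).bddAbove x).trans (le_max_right _ _)
  have hcover : {G | ¬ SpreadsMass L ν G} ⊆
      {G | ∃ y, 0.4 * L * b < ∑ x ∈ G.neighborFinset y, ν x} ∪
      {G | ∃ y, (∀ x, ν x ≤ 7 / Fintype.card V) ∧
        ∑ x ∈ G.neighborFinset y, ν x < 0.14 * L / Fintype.card V} := by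
    intro G hG
    by_contra! hcon
    simp only [Set.mem_union, Set.mem_ofPred_eq, not_or, not_exists, not_and, not_lt] at hcon
    refine hG ⟨fun b' hb' hνb' y => (hcon.1 y).trans ?_, fun hflat y => hcon.2 y hflat⟩
    gcongr
    exact max_le hb' (ciSup_le hνb')
  have hupper := measureReal_exists_le_mul
    (measureReal_lt_sum_neighborFinset p hcard hL hlog hν (le_max_left _ _) hνb)
  have hlower : ∀ y, (SimpleGraph.binomialRandom V p).real {G | (∀ x, ν x ≤ 7 / Fintype.card V) ∧
      ∑ x ∈ G.neighborFinset y, ν x < 0.14 * L / Fintype.card V} ≤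
      1 / (Fintype.card V : ℝ) ^ 3 := fun y => by
    by_cases hflat : ∀ x, ν x ≤ 7 / Fintype.card V
    · simpa only [hflat, implies_true, true_and] using
        measureReal_sum_neighborFinset_lt p hcard hL hlog hν hflat y
    · simp only [hflat, false_and, Set.ofPred_false, measureReal_empty]
      positivity
  refine (measureReal_mono hcover).trans <| (measureReal_union_le _ _).trans <|
    (add_le_add hupper (measureReal_exists_le_mul hlower)).trans_eq ?_
  field_simp
  norm_num

end BadGraphs

section InfinitePi

open ProbabilityTheory

variable {Ω : Type*} [MeasurableSpace Ω]

lemma measureReal_prodMk_mem_le {α β : Type*} [MeasurableSpace α] [MeasurableSpace β]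
    {μ : Measure Ω} [IsProbabilityMeasure μ] {f : Ω → α} {g : Ω → β} (hf : Measurable f)
    (hg : Measurable g) (hfg : IndepFun f g μ) {E : Set (α × β)} (hE : MeasurableSet E) {c : ℝ}
    (hc : ∀ a, (μ.map g).real (Prod.mk a ⁻¹' E) ≤ c) : μ.real {ω | (f ω, g ω) ∈ E} ≤ c := by
  have := Measure.isProbabilityMeasure_map (μ := μ) hf.aemeasurable
  have := Measure.isProbabilityMeasure_map (μ := μ) hg.aemeasurable
  obtain ⟨ω⟩ := nonempty_of_isProbabilityMeasure μ
  refine ENNReal.toReal_le_of_le_ofReal (measureReal_nonneg.trans (hc (f ω))) ?_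
  calc μ ((fun ω => (f ω, g ω)) ⁻¹' E) = (μ.map f).prod (μ.map g) E := by
        rw [← Measure.map_apply (hf.prodMk hg) hE,
          (indepFun_iff_map_prod_eq_prod_map_map hf.aemeasurable hg.aemeasurable).1 hfg]
    _ ≤ ∫⁻ a, (μ.map g) (Prod.mk a ⁻¹' E) ∂(μ.map f) := Measure.prod_apply_le hE
    _ ≤ ENNReal.ofReal c := lintegral_le_const <| .of_forall fun a =>
        (ENNReal.le_ofReal_iff_toReal_le (measure_ne_top _ _)
          (measureReal_nonneg.trans (hc a))).2 (hc a)

lemma measure_eventually_mem_atBot_le {ι : Type*} [Preorder ι] [IsCodirectedOrder ι] [Nonempty ι]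
    [(atBot : Filter ι).IsCountablyGenerated] {μ : Measure Ω} {B : ι → Set Ω} {c : ENNReal}
    (hB : ∀ i, μ (B i) ≤ c) : μ {ω | ∀ᶠ i in atBot, ω ∈ B i} ≤ c := by
  have hanti : Antitone fun i => {ω | ∀ j ≤ i, ω ∈ B j} := fun _ _ hi _ hω j hj =>
    hω j (hj.trans hi)
  simp only [eventually_atBot, Set.ofPred_exists, hanti.measure_iUnion, iSup_le_iff]
  exact fun i => (measure_mono fun ω (hω : ∀ j ≤ i, ω ∈ B j) => hω i le_rfl).trans (hB i)

variable {X ι : Type*} [MeasurableSpace X] (ν : Measure X) [IsProbabilityMeasure ν]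

lemma infinitePi_real_mem_le [Finite X] [MeasurableSingletonClass X] {F : Finset ι} {i : ι}
    (hi : i ∉ F) {D : (ι → X) → Set X} (hD : DependsOn D F) {c : ℝ}
    (hc : ∀ ω, ν.real (D ω) ≤ c) :
    (Measure.infinitePi fun _ : ι => ν).real {ω | ω i ∈ D ω} ≤ c := by
  obtain ⟨D', rfl⟩ := dependsOn_iff_exists_comp.1 hD
  have hindep : IndepFun (fun ω (j : F) => ω j) (fun ω : ι → X => ω i)
      (Measure.infinitePi fun _ : ι => ν) :=
    ((iIndepFun_infinitePi (X := fun _ x => x) fun _ => measurable_id).indepFun_finset F {i}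
      (Finset.disjoint_singleton_right.2 hi) measurable_pi_apply).comp measurable_id
      (measurable_pi_apply ⟨i, Finset.mem_singleton_self i⟩)
  refine measureReal_prodMk_mem_le (by fun_prop) (measurable_pi_apply i) hindep
    (E := {q | q.2 ∈ D' q.1}) (Set.toFinite _).measurableSet fun η => ?_
  obtain ⟨x⟩ := nonempty_of_isProbabilityMeasure ν
  obtain ⟨ω, rfl⟩ : ∃ ω : ι → X, (fun j : F => ω j) = η := by
    classical
    exact ⟨fun j => if hj : j ∈ F then η ⟨j, hj⟩ else x, by ext; simp⟩
  rw [Measure.infinitePi_map_eval]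
  exact hc ω

lemma infinitePi_ae_frequently_mem {u : ℕ → ι} (hu : u.Injective) {S : Set X}
    (hS : MeasurableSet S) (hνS : ν S ≠ 0) :
    ∀ᵐ ω ∂(Measure.infinitePi fun _ : ι => ν), ∃ᶠ k in atTop, ω (u k) ∈ S := by
  have hmeas : ∀ k, MeasurableSet {ω : ι → X | ω (u k) ∈ S} := fun k =>
    measurable_pi_apply (u k) hS
  have hindep : iIndepSet (fun k => {ω : ι → X | ω (u k) ∈ S})
      (Measure.infinitePi fun _ : ι => ν) :=
    (iIndepSet_iff_meas_biInter hmeas).2 fun s =>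
      ((iIndepFun_infinitePi (X := fun _ x => x) fun _ => measurable_id).precomp hu).meas_biInter
        fun k _ => ⟨S, hS, rfl⟩
  have hprob : ∀ k, (Measure.infinitePi fun _ : ι => ν) {ω | ω (u k) ∈ S} = ν S := fun k =>
    (measurePreserving_eval_infinitePi _ (u k)).measure_preimage hS.nullMeasurableSet
  have hlimsup := measure_limsup_eq_one hmeas hindep
    (by simp_rw [hprob, ENNReal.tsum_const_eq_top_of_ne_zero hνS])
  filter_upwards [(mem_ae_iff_prob_eq_one (.measurableSet_limsup hmeas)).2 hlimsup] with ω hω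
  exact mem_limsup_iff_frequently_mem.1 hω

end InfinitePi

section GoodRuns

open unitInterval
open scoped Classical

variable {V : Type*} [Fintype V] {L : ℝ} {x₀ : V} {s : ℤ} {G : ℤ → SimpleGraph V}

/-- In the time window `(-|V|, |V|]` the graphs of `G` are expanders and spread the mass of the walk
that starts at `x₀` at time `s`. The first half of the window serves to flatten the walk, so that
it is flat throughout `[0, |V|]`. -/
def IsGoodRun (L : ℝ) (x₀ : V) (s : ℤ) (G : ℤ → SimpleGraph V) : Prop :=
  ∀ t ∈ Set.Ioc (-(Fintype.card V : ℤ)) (Fintype.card V), IsNearRegularExpander L (G t) ∧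
    SpreadsMass L (transitionProd (fun u => lazyWalk (G u)) s (t - 1) x₀) (G t)

lemma measureReal_not_isGoodRun {p : I} (hcard : 400 ≤ Fintype.card V)
    (hL : p * ((Fintype.card V : ℝ) - 1) = L) (hlog : 50 * Real.log (Fintype.card V) ≤ L)
    (x₀ : V) (s : ℤ) :
    (Measure.infinitePi fun _ : ℤ => SimpleGraph.binomialRandom V p).real
      {G | ¬ IsGoodRun L x₀ s G} ≤ 12 / Fintype.card V := by
  have hwindow : ∀ G : ℤ → SimpleGraph V, ¬ IsGoodRun L x₀ s G ↔
      ∃ t : Finset.Ioc (-(Fintype.card V : ℤ)) (Fintype.card V),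
        ¬ (IsNearRegularExpander L (G t) ∧
          SpreadsMass L (transitionProd (fun u => lazyWalk (G u)) s (t - 1) x₀) (G t)) := by
    intro G
    simp only [IsGoodRun, not_forall, Subtype.exists, Finset.mem_Ioc, Set.mem_Ioc]
  simp_rw [hwindow]
  refine (measureReal_exists_le_mul (c := 4 / (Fintype.card V : ℝ) ^ 2 + 2 / Fintype.card V ^ 2)
    fun t => ?_).trans_eq ?_
  · refine infinitePi_real_mem_le _ (F := Finset.Ioc s (t - 1)) (by simp)
      (D := fun G => {H | ¬ (IsNearRegularExpander L H ∧
        SpreadsMass L (transitionProd (fun u => lazyWalk (G u)) s (t - 1) x₀) H)}) ?_ fun G => ?_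
    · intro G G' hGG'
      have hprod : transitionProd (fun u => lazyWalk (G u)) s (t - 1) =
          transitionProd (fun u => lazyWalk (G' u)) s (t - 1) :=
        transitionProd_congr fun u hu => congrArg lazyWalk (hGG' u (Finset.mem_coe.2
          (Finset.mem_Ioc.2 hu)))
      simp only [hprod]
    · simp only [not_and_or, Set.ofPred_or]
      exact (measureReal_union_le _ _).trans <| add_le_add
        (measureReal_not_isNearRegularExpander p hcard hL hlog)
        (measureReal_not_spreadsMass p hcard hL hlog (row_mem_stdSimplex
          (transitionProd_mem_rowStochastic (fun u => lazyWalk_mem_rowStochastic (G u)) _ _) x₀))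
  · have hcard0 : (Fintype.card V : ℝ) ≠ 0 := by positivity
    have hlength : Fintype.card (Finset.Ioc (-(Fintype.card V : ℤ)) (Fintype.card V)) =
        2 * Fintype.card V := by
      rw [Fintype.card_coe, Int.card_Ioc]
      omega
    rw [hlength]
    push_cast
    field_simp
    norm_num

lemma IsGoodRun.transitionProd_le (hL : 0 < L) (hG : IsGoodRun L x₀ s G)
    (hs : s ≤ -Fintype.card V) {j : ℕ} (hj : j ≤ 2 * Fintype.card V) (y : V) :
    transitionProd (fun u => lazyWalk (G u)) s (-Fintype.card V + j) x₀ y ≤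
      max (7 / Fintype.card V : ℝ) (0.9 ^ j) := by
  have hrow : ∀ t, transitionProd (fun u => lazyWalk (G u)) s t x₀ ∈ stdSimplex ℝ V := fun t =>
    row_mem_stdSimplex
      (transitionProd_mem_rowStochastic (fun u => lazyWalk_mem_rowStochastic (G u)) s t) x₀
  induction j generalizing y with
  | zero => exact le_max_of_le_right ((mem_Icc_of_mem_stdSimplex (hrow _) y).2.trans_eq (by simp))
  | succ j ih =>
    obtain ⟨hexpander, hspread⟩ := hG (-Fintype.card V + j + 1)
      ⟨by omega, by omega⟩
    rw [add_sub_cancel_right] at hspread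
    rw [Nat.cast_succ, ← add_assoc, transitionProd_succ_right _ (by omega),
      Matrix.mul_apply_eq_vecMul]
    refine (hexpander.vecMul_lazyWalk_le hL (hrow _).1 hspread (le_max_left _ _)
      (ih (by omega)) y).trans ?_
    rw [mul_max_of_nonneg _ _ (by norm_num), pow_succ']
    exact max_le_max_right _ (mul_le_of_le_one_left (by positivity) (by norm_num))

lemma pow_le_seven_div_succ {j : ℕ} (hj : 9 ≤ j) : (0.9 : ℝ) ^ j ≤ 7 / (j + 1) := by
  induction j, hj using Nat.le_induction with
  | base => norm_num
  | succ j hj ih =>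
    have hj' : (9 : ℝ) ≤ j := by exact_mod_cast hj
    calc (0.9 : ℝ) ^ (j + 1) = 0.9 * 0.9 ^ j := pow_succ' _ _
      _ ≤ 0.9 * (7 / (j + 1)) := by gcongr
      _ ≤ 7 / ((j + 1 : ℕ) + 1) := by
        rw [← mul_div_assoc, div_le_div_iff₀ (by positivity) (by positivity)]
        push_cast
        linarith

lemma IsGoodRun.transitionProd_le_seven_div (hL : 0 < L) (hG : IsGoodRun L x₀ s G)
    (hcard : 10 ≤ Fintype.card V) (hs : s ≤ -Fintype.card V) {t : ℤ}
    (ht : t ∈ Set.Icc (-1 : ℤ) (Fintype.card V)) (y : V) :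
    transitionProd (fun u => lazyWalk (G u)) s t x₀ y ≤ 7 / Fintype.card V := by
  obtain ⟨ht₁, ht₂⟩ := ht
  obtain ⟨j, hj⟩ : ∃ j : ℕ, t = -Fintype.card V + j := ⟨(t + Fintype.card V).toNat, by omega⟩
  have hpow : (0.9 : ℝ) ^ j ≤ 7 / Fintype.card V := by
    refine (pow_le_seven_div_succ (by omega)).trans ?_
    gcongr
    exact_mod_cast (by omega : Fintype.card V ≤ j + 1)
  rw [hj]
  exact (hG.transitionProd_le hL hs (by omega) y).trans (max_le le_rfl hpow)

lemma IsGoodRun.transitionProd_mem_Icc (hL : 0 < L) (hG : IsGoodRun L x₀ s G)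
    (hcard : 10 ≤ Fintype.card V) (hs : s ≤ -Fintype.card V) {t : ℤ}
    (ht : t ∈ Set.Icc (0 : ℤ) (Fintype.card V)) (y : V) :
    transitionProd (fun u => lazyWalk (G u)) s t x₀ y ∈
      Set.Icc (0.035 / Fintype.card V : ℝ) (7 / Fintype.card V) := by
  obtain ⟨ht₀, ht₁⟩ := ht
  refine ⟨?_, hG.transitionProd_le_seven_div hL hcard hs ⟨by omega, ht₁⟩ y⟩
  obtain ⟨hexpander, hspread⟩ := hG t ⟨by omega, ht₁⟩
  have hstep : transitionProd (fun u => lazyWalk (G u)) s t =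
      transitionProd (fun u => lazyWalk (G u)) s (t - 1) * lazyWalk (G t) := by
    simpa using transitionProd_succ_right (fun u => lazyWalk (G u)) (s := s) (t := t - 1) (by omega)
  rw [hstep, Matrix.mul_apply_eq_vecMul]
  exact hexpander.le_vecMul_lazyWalk hL
    (fun _ => Matrix.nonneg_of_mem_rowStochastic (transitionProd_mem_rowStochastic
      (fun u => lazyWalk_mem_rowStochastic (G u)) _ _)) hspread
    (hG.transitionProd_le_seven_div hL hcard hs ⟨by omega, by omega⟩) y

lemma sq_le_Theta_of_frequently_isGoodRun (hL : 0 < L) (hcard : 14 ≤ Fintype.card V)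
    (hex : ∀ t, TargetExists (fun u => lazyWalk (G u)) t)
    (hG : ∃ᶠ s in atBot, IsGoodRun L x₀ s G) {c : ℝ} (hc0 : 0 ≤ c)
    (hc : c ≤ 0.035 / (2 * 7 - 0.035) * (0.035 / (40 * 7))) {t : ℤ}
    (ht : t ∈ Set.Icc (0 : ℤ) (Fintype.card V)) :
    ((c ^ 2 : ℝ) : EReal) ≤ Theta (fun u => lazyWalk (G u)) t := by
  have : Nonempty V := ⟨x₀⟩
  have hcard' : (14 : ℝ) ≤ Fintype.card V := by exact_mod_cast hcard
  have hπ : ∀ u ∈ Set.Icc 0 t, ∀ x, target (fun u => lazyWalk (G u)) u x ∈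
      Set.Icc (0.035 / Fintype.card V : ℝ) (7 / Fintype.card V) := fun u hu =>
    target_mem_Icc_of_frequently (hex u) <|
      (hG.and_eventually (eventually_le_atBot _)).mono fun s hs =>
        hs.1.transitionProd_mem_Icc hL (by omega) hs.2 ⟨hu.1, hu.2.trans ht.2⟩
  obtain ⟨s, hs⟩ := hG.exists
  refine sq_le_Theta (fun u => lazyWalk_mem_rowStochastic (G u)) hex (by positivity) hπ
    (φ := 0.035 / Fintype.card V / (40 * (7 / Fintype.card V))) (by positivity) (fun u hu => ?_)
    hc0 (hc.trans_eq ?_)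
  · refine (hs u ⟨by linarith [hu.1], hu.2.trans ht.2⟩).1.le_bottleneckRatio hL (hex _)
      (by positivity) ?_ (hπ _ ⟨by linarith [hu.1], by linarith [hu.2]⟩)
    rw [div_le_div_iff₀ (by positivity) (by norm_num)]
    linarith
  · field_simp

end GoodRuns

section Assembly

open unitInterval
open scoped Classical

variable {V : Type*}

lemma binomialRandom_singleton_top_ne_zero [Finite V] {p : I} (hp : p ≠ 0) :
    SimpleGraph.binomialRandom V p {⊤} ≠ 0 := by
  have hncard : (⊤ : SimpleGraph V).edgeSet.ncard = (Nat.card V).choose 2 := by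
    have := Fintype.ofFinite V
    rw [Set.ncard_eq_toFinset_card', ← SimpleGraph.edgeFinset,
      SimpleGraph.card_edgeFinset_top_eq_card_choose_two, Nat.card_eq_fintype_card]
  rw [SimpleGraph.binomialRandom_singleton, hncard, Nat.sub_self, pow_zero, mul_one]
  exact pow_ne_zero _ (ENNReal.coe_ne_zero.2 fun h =>
    hp (Subtype.ext (congrArg NNReal.toReal h)))

lemma ae_frequently_eq_top [Finite V] {p : I} (hp : p ≠ 0) :
    ∀ᵐ G ∂(Measure.infinitePi fun _ : ℤ => SimpleGraph.binomialRandom V p),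
      ∃ᶠ u in atBot, G u = ⊤ := by
  filter_upwards [infinitePi_ae_frequently_mem (SimpleGraph.binomialRandom V p)
    (u := fun k : ℕ => 0 - (k : ℤ)) (sub_right_injective.comp Nat.cast_injective)
    (measurableSet_singleton ⊤) (binomialRandom_singleton_top_ne_zero hp)] with G hG
  rwa [← map_sub_natCast_atTop 0, frequently_map]

variable [Fintype V]

lemma targetExists_of_frequently_eq_top [Nonempty V] {G : ℤ → SimpleGraph V}
    (hG : ∃ᶠ u in atBot, G u = ⊤) (t : ℤ) : TargetExists (fun u => lazyWalk (G u)) t :=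
  targetExists_of_frequently_pos (fun u => lazyWalk_mem_rowStochastic (G u))
    (ε := 1 / (2 * Fintype.card V)) (by positivity)
    (hG.mono fun u hu x y => le_lazyWalk_of_eq_or_adj (hu ▸ eq_or_ne x y)) t

lemma one_sub_le_measure_forall_le_Theta {p : I} {L : ℝ} (hcard : 400 ≤ Fintype.card V)
    (hL : p * ((Fintype.card V : ℝ) - 1) = L) (hlog : 50 * Real.log (Fintype.card V) ≤ L)
    {c : ℝ} (hc0 : 0 ≤ c) (hc : c ≤ 0.035 / (2 * 7 - 0.035) * (0.035 / (40 * 7))) :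
    1 - ENNReal.ofReal (12 / Fintype.card V) ≤
      (Measure.infinitePi fun _ : ℤ => SimpleGraph.binomialRandom V p)
        {G | (∀ t, TargetExists (fun u => lazyWalk (G u)) t) ∧
          ∀ t ∈ Set.Icc (0 : ℤ) (Fintype.card V),
            ((c ^ 2 : ℝ) : EReal) ≤ Theta (fun u => lazyWalk (G u)) t} := by
  have hL0 : 0 < L := by linarith [one_le_log (r := Fintype.card V) (by exact_mod_cast hcard)]
  have hp0 : p ≠ 0 := by
    rintro rfl
    exact hL0.ne (by rw [← hL, Set.Icc.coe_zero, zero_mul])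
  obtain ⟨x₀⟩ : Nonempty V := Fintype.card_pos_iff.1 (by omega)
  set event := {G : ℤ → SimpleGraph V | (∀ t, TargetExists (fun u => lazyWalk (G u)) t) ∧
    ∀ t ∈ Set.Icc (0 : ℤ) (Fintype.card V),
      ((c ^ 2 : ℝ) : EReal) ≤ Theta (fun u => lazyWalk (G u)) t}
  set μ := Measure.infinitePi fun _ : ℤ => SimpleGraph.binomialRandom V p
  have hcompl : μ eventᶜ ≤ μ {G | ∀ᶠ s in atBot, G ∈ {G | ¬ IsGoodRun L x₀ s G}} := by
    refine measure_mono_ae ?_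
    filter_upwards [ae_frequently_eq_top hp0] with G htop hG
    by_contra hgood
    have : Nonempty V := ⟨x₀⟩
    have hex := targetExists_of_frequently_eq_top htop
    exact hG ⟨hex, fun t ht => sq_le_Theta_of_frequently_isGoodRun hL0 (by omega) hex
      ((not_eventually.1 hgood).mono fun s hs => not_not.1 hs) hc0 hc ht⟩
  have hbad : μ {G | ∀ᶠ s in atBot, G ∈ {G | ¬ IsGoodRun L x₀ s G}} ≤
      ENNReal.ofReal (12 / Fintype.card V) :=
    measure_eventually_mem_atBot_le fun s =>
      (ENNReal.le_ofReal_iff_toReal_le (measure_ne_top _ _) (by positivity)).2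
        (measureReal_not_isGoodRun hcard hL hlog x₀ s)
  rw [tsub_le_iff_right]
  calc 1 = μ Set.univ := measure_univ.symm
    _ ≤ μ event + μ eventᶜ := measure_univ_le_add_compl _
    _ ≤ μ event + ENNReal.ofReal (12 / Fintype.card V) := by
      gcongr
      exact hcompl.trans hbad

end Assembly

end DynamicGraph

theorem mainTheorem5_general {p : ℕ → unitInterval}
    (hp : ∀ᶠ n : ℕ in atTop, 50 * Real.log n ≤ p n * ((n : ℝ) - 1)) {c : ℝ} (hc0 : 0 ≤ c)
    (hc : c ≤ 0.035 / (2 * 7 - 0.035) * (0.035 / (40 * 7))) :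
    Tendsto
      (fun n : ℕ => DynamicGraph.dynamicER n (p n)
        {G : ℤ → SimpleGraph (Fin n) |
          (∀ t : ℤ, DynamicGraph.TargetExists (fun s => DynamicGraph.lazyWalk (G s)) t) ∧
          ∀ t ∈ Set.Icc (0 : ℤ) (n : ℤ),
            ((c ^ 2 : ℝ) : EReal) ≤ DynamicGraph.Theta (fun s => DynamicGraph.lazyWalk (G s)) t})
      atTop (𝓝 1) := by
  have herror : Tendsto (fun n : ℕ => 1 - ENNReal.ofReal (12 / n)) atTop (𝓝 1) := by
    simpa using ENNReal.Tendsto.sub (a := 1) tendsto_const_nhds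
      (ENNReal.tendsto_ofReal (tendsto_const_div_atTop_nhds_zero_nat (12 : ℝ))) (by simp)
  refine tendsto_of_tendsto_of_tendsto_of_le_of_le' herror tendsto_const_nhds ?_
    (.of_forall fun n => (prob_le_one (μ := Measure.infinitePi fun _ : ℤ => _)))
  filter_upwards [hp, eventually_ge_atTop 400] with n hpn hn
  have hbound := DynamicGraph.one_sub_le_measure_forall_le_Theta (V := Fin n) (p := p n)
    (by rwa [Fintype.card_fin]) rfl (by rwa [Fintype.card_fin]) hc0 hc
  rw [Fintype.card_fin] at hbound
  convert hbound <;> rfl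

theorem mainTheorem5 (η : ℝ) (hη : 50 < η) (p : ℕ → unitInterval)
    (hp : ∀ᶠ n : ℕ in atTop, (p n : ℝ) = η * Real.log n / ((n : ℝ) - 1))
    (α₁ α₂ : ℝ) (hα₁ : α₁ = 0.002) (hα₂ : α₂ = 7) :
    Tendsto
      (fun n : ℕ => DynamicGraph.dynamicER n (p n)
        {G : ℤ → SimpleGraph (Fin n) |
          (∀ t : ℤ, DynamicGraph.TargetExists (fun s => DynamicGraph.lazyWalk (G s)) t) ∧
          ∀ t ∈ Set.Icc (0 : ℤ) (n : ℤ),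
            (((α₁ / (2 * α₂ - α₁) * (α₁ / (32 * α₂ ^ 2))) ^ 2 : ℝ) : EReal) ≤
              DynamicGraph.Theta (fun s => DynamicGraph.lazyWalk (G s)) t})
      atTop (𝓝 1) := by
  subst hα₁ hα₂
  refine mainTheorem5_general ?_ (by norm_num) (by norm_num)
  filter_upwards [hp, eventually_ge_atTop 2] with n hpn hn
  have hn' : (2 : ℝ) ≤ n := by exact_mod_cast hn
  rw [hpn, div_mul_cancel₀ _ (by linarith)]
  exact mul_le_mul_of_nonneg_right hη.le (Real.log_nonneg (by linarith))
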